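/- Let $\phi\in L^2(\mathbf R)$ with $\|\phi\|=1$, and for $(\tau,\sigma)\in\mathbf R^2$ let $\rho(\tau,\sigma)\phi(t)=e^{\pi i\tau\sigma}e^{2\pi i\sigma t}\phi(t+\tau)$. For $f\in L^2(\mathbf R)$ let $\mathcal S_\phi f(\tau,\sigma)=\langle f,\rho(\tau,\sigma)\phi\rangle=\int_{\mathbf R} f(t)\,\overline{\rho(\tau,\sigma)\phi(t)}\,dt$ be its Gabor transform. For a bounded measurable set $\Omega\subset\mathbf R^2$ let $\mathcal C_\Omega$ be the concentration operator, i.e. the unique bounded operator on $L^2(\mathbf R)$ such that $$\langle \mathcal C_\Omega f,g\rangle=\iint_\Omega \mathcal S_\phi f(\tau,\sigma)\,\overline{\mathcal S_\phi g(\tau,\sigma)}\,d\tau\,d\sigma\qquad\text{for all } f,g\in L^2(\mathbf R).$$ For real $\lambda$, let $n(\lambda,\Omega)$ be the number of eigenvalues of $\mathcal C_\Omega$ that are $\ge\lambda$, counted with multiplicity, and for $r>0$ let $\Omega_r=\{(r\tau,r\sigma):(\tau,\sigma)\in\Omega\}$. Theorem. Let $\Omega\subset\mathbf R^2$ be a bounded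 measurable set of positive area and let $0<\lambda<1$. Then $$\liminf_{r\to\infty}\frac{n(\lambda,\Omega_r)}{\mathrm{area}(\Omega_r)}=1 .$$ -/

import Mathlib

open MeasureTheory Filter
open scoped ENNReal Pointwise ComplexConjugate

/-- The complex Hilbert space `L²(ℝ)` of signals. -/
abbrev SignalSpace : Type := Lp ℂ 2 (volume : Measure ℝ)

/-- The time-frequency shift
`ρ(τ, σ) f (t) = exp (π i τ σ) exp (2 π i σ t) f (t + τ)`. -/
noncomputable def timeFreqShift (τ σ : ℝ) (f : ℝ → ℂ) (t : ℝ) : ℂ :=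
  Complex.exp (Real.pi * Complex.I * τ * σ) * Complex.exp (2 * Real.pi * Complex.I * σ * t)
    * f (t + τ)

/-- The Gabor transform `S_φ f (τ, σ) = ⟨f, ρ(τ, σ) φ⟩ = ∫ f(t) conj (ρ(τ, σ) φ (t)) dt`. -/
noncomputable def gaborTransform (φ f : SignalSpace) (p : ℝ × ℝ) : ℂ :=
  ∫ t : ℝ, f t * conj (timeFreqShift p.1 p.2 φ t)

/-- The Hermitian form `E_Ω(f, g) = ∬_Ω S_φ f · conj (S_φ g)`, the energy of the
Gabor transform inside `Ω`. -/
noncomputable def concentrationForm (φ : SignalSpace) (Ω : Set (ℝ × ℝ)) (f g : SignalSpace) : ℂ :=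
  ∫ p in Ω, gaborTransform φ f p * conj (gaborTransform φ g p)

lemma norm_timeFreqShift (τ σ : ℝ) (f : ℝ → ℂ) (t : ℝ) :
    ‖timeFreqShift τ σ f t‖ = ‖f (t + τ)‖ := by
  have h1 : (Real.pi * Complex.I * τ * σ : ℂ) = ((Real.pi * τ * σ : ℝ) : ℂ) * Complex.I := by
    push_cast; ring
  have h2 : (2 * Real.pi * Complex.I * σ * t : ℂ)
      = ((2 * Real.pi * σ * t : ℝ) : ℂ) * Complex.I := by
    push_cast; ring
  simp only [timeFreqShift, norm_mul]
  rw [h1, h2, Complex.norm_exp_ofReal_mul_I, Complex.norm_exp_ofReal_mul_I]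
  simp

lemma memLp_timeFreqShift (τ σ : ℝ) (φ : SignalSpace) :
    MemLp (timeFreqShift τ σ φ) 2 volume := by
  have h : MemLp (fun t => (φ : ℝ → ℂ) (t + τ)) 2 volume :=
    (Lp.memLp φ).comp_measurePreserving (measurePreserving_add_right volume τ)
  refine (memLp_congr_norm ?_ h.1 (Eventually.of_forall fun t => norm_timeFreqShift τ σ φ t)).2 h
  unfold timeFreqShift
  exact (Continuous.aestronglyMeasurable (by fun_prop)).mul h.1

/-- The time-frequency shift of a signal, as an element of `L²(ℝ)`. -/
noncomputable def shiftLp (φ : SignalSpace) (p : ℝ × ℝ) : SignalSpace :=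
  (memLp_timeFreqShift p.1 p.2 φ).toLp _

lemma norm_shiftLp (φ : SignalSpace) (p : ℝ × ℝ) : ‖shiftLp φ p‖ = ‖φ‖ := by
  rw [shiftLp, Lp.norm_toLp, Lp.norm_def]
  congr 1
  rw [eLpNorm_congr_norm_ae (g := fun t => (φ : ℝ → ℂ) (t + p.1))
    (Eventually.of_forall fun t => norm_timeFreqShift p.1 p.2 φ t)]
  exact eLpNorm_comp_measurePreserving (Lp.memLp φ).1 (measurePreserving_add_right volume p.1)

lemma gaborTransform_eq_inner (φ f : SignalSpace) (p : ℝ × ℝ) :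
    gaborTransform φ f p = inner ℂ (shiftLp φ p) f := by
  rw [L2.inner_def, gaborTransform]
  refine integral_congr_ae ?_
  filter_upwards [(memLp_timeFreqShift p.1 p.2 φ).coeFn_toLp] with t ht
  simp only [shiftLp, RCLike.inner_apply, ht]

lemma norm_gaborTransform_le (φ f : SignalSpace) (p : ℝ × ℝ) :
    ‖gaborTransform φ f p‖ ≤ ‖φ‖ * ‖f‖ := by
  rw [gaborTransform_eq_inner, ← norm_shiftLp φ p]
  exact norm_inner_le_norm _ _

lemma stronglyMeasurable_gaborTransform (φ f : SignalSpace) :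
    StronglyMeasurable (gaborTransform φ f) := by
  have hφ := (Lp.stronglyMeasurable φ).measurable
  have hf := (Lp.stronglyMeasurable f).measurable
  refine StronglyMeasurable.integral_prod_right (ν := (volume : Measure ℝ))
    (f := fun (p : ℝ × ℝ) (t : ℝ) => (f : ℝ → ℂ) t * conj (timeFreqShift p.1 p.2 φ t)) ?_
  refine Measurable.stronglyMeasurable ?_
  unfold timeFreqShift
  have h1 : Measurable fun q : (ℝ × ℝ) × ℝ => (f : ℝ → ℂ) q.2 := hf.comp measurable_snd
  have h2 : Measurable fun q : (ℝ × ℝ) × ℝ => (φ : ℝ → ℂ) (q.2 + q.1.1) :=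
    hφ.comp (by fun_prop)
  have h3 : Measurable fun q : (ℝ × ℝ) × ℝ =>
      Complex.exp (Real.pi * Complex.I * q.1.1 * q.1.2)
        * Complex.exp (2 * Real.pi * Complex.I * q.1.2 * q.2) :=
    Continuous.measurable (by fun_prop)
  exact h1.mul (Complex.continuous_conj.measurable.comp (h3.mul h2))

lemma norm_concentration_le (φ f g : SignalSpace) (p : ℝ × ℝ) :
    ‖gaborTransform φ f p * conj (gaborTransform φ g p)‖ ≤ ‖φ‖ * ‖f‖ * (‖φ‖ * ‖g‖) := by
  rw [norm_mul, RCLike.norm_conj]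
  exact mul_le_mul (norm_gaborTransform_le φ f p) (norm_gaborTransform_le φ g p)
    (norm_nonneg _) (by positivity)

lemma integrableOn_concentration (φ : SignalSpace) {Ω : Set (ℝ × ℝ)}
    (hΩ : Bornology.IsBounded Ω) (f g : SignalSpace) :
    IntegrableOn (fun p => gaborTransform φ f p * conj (gaborTransform φ g p)) Ω := by
  refine IntegrableOn.of_bound hΩ.measure_lt_top ?_ (‖φ‖ * ‖f‖ * (‖φ‖ * ‖g‖))
    (Eventually.of_forall (norm_concentration_le φ f g))
  exact ((stronglyMeasurable_gaborTransform φ f).mul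
    (Complex.continuous_conj.comp_stronglyMeasurable
      (stronglyMeasurable_gaborTransform φ g))).aestronglyMeasurable

lemma concentrationForm_conj (φ : SignalSpace) (Ω : Set (ℝ × ℝ)) (f g : SignalSpace) :
    conj (concentrationForm φ Ω f g) = concentrationForm φ Ω g f := by
  rw [concentrationForm, concentrationForm, ← integral_conj]
  refine integral_congr_ae (Eventually.of_forall fun p => ?_)
  simp [mul_comm]

lemma concentrationForm_add_left (φ : SignalSpace) {Ω : Set (ℝ × ℝ)}
    (hΩ : Bornology.IsBounded Ω) (f₁ f₂ g : SignalSpace) :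
    concentrationForm φ Ω (f₁ + f₂) g = concentrationForm φ Ω f₁ g + concentrationForm φ Ω f₂ g := by
  rw [concentrationForm, concentrationForm, concentrationForm,
    ← integral_add (integrableOn_concentration φ hΩ f₁ g) (integrableOn_concentration φ hΩ f₂ g)]
  refine integral_congr_ae (Eventually.of_forall fun p => ?_)
  simp only [gaborTransform_eq_inner, inner_add_right, add_mul]

lemma concentrationForm_smul_left (φ : SignalSpace) (Ω : Set (ℝ × ℝ)) (c : ℂ)
    (f g : SignalSpace) :
    concentrationForm φ Ω (c • f) g = c * concentrationForm φ Ω f g := by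
  rw [concentrationForm, concentrationForm, ← integral_const_mul]
  refine integral_congr_ae (Eventually.of_forall fun p => ?_)
  simp only [gaborTransform_eq_inner, inner_smul_right, mul_assoc]

lemma norm_concentrationForm_le (φ : SignalSpace) {Ω : Set (ℝ × ℝ)}
    (hΩ : Bornology.IsBounded Ω) (f g : SignalSpace) :
    ‖concentrationForm φ Ω f g‖ ≤ ‖φ‖ * ‖φ‖ * volume.real Ω * ‖g‖ * ‖f‖ := by
  refine (norm_setIntegral_le_of_norm_le_const hΩ.measure_lt_top
    (fun p _ => norm_concentration_le φ f g p)).trans (le_of_eq ?_)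
  ring

/-- On a bounded region the form `E_Ω` is represented by a unique bounded operator. -/
theorem existsUnique_concentrationOp (φ : SignalSpace) {Ω : Set (ℝ × ℝ)}
    (hΩ : Bornology.IsBounded Ω) :
    ∃! C : SignalSpace →L[ℂ] SignalSpace,
      ∀ f g : SignalSpace, inner ℂ g (C f) = concentrationForm φ Ω f g := by
  let B : SignalSpace →ₗ⋆[ℂ] SignalSpace →ₗ[ℂ] ℂ :=
    LinearMap.mk₂'ₛₗ (starRingEnd ℂ) (RingHom.id ℂ) (fun v w => concentrationForm φ Ω w v)
      (fun v₁ v₂ w => by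
        rw [← concentrationForm_conj φ Ω (v₁ + v₂) w, concentrationForm_add_left φ hΩ, map_add,
          concentrationForm_conj, concentrationForm_conj])
      (fun c v w => by
        rw [← concentrationForm_conj φ Ω (c • v) w, concentrationForm_smul_left, map_mul,
          concentrationForm_conj, smul_eq_mul])
      (fun v w₁ w₂ => concentrationForm_add_left φ hΩ w₁ w₂ v)
      (fun c v w => concentrationForm_smul_left φ Ω c w v)
  let B' : SignalSpace →L⋆[ℂ] SignalSpace →L[ℂ] ℂ :=
    B.mkContinuous₂ (‖φ‖ * ‖φ‖ * volume.real Ω)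
      (fun v w => norm_concentrationForm_le φ hΩ w v)
  refine ⟨InnerProductSpace.continuousLinearMapOfBilin B', fun f g => ?_, fun C hC => ?_⟩
  · rw [← inner_conj_symm, InnerProductSpace.continuousLinearMapOfBilin_apply]
    exact concentrationForm_conj φ Ω g f
  · ext1 f
    refine InnerProductSpace.unique_continuousLinearMapOfBilin B' fun g => ?_
    rw [← inner_conj_symm, hC]
    exact concentrationForm_conj φ Ω f g

open Classical in
/-- The concentration operator `C_Ω`: the bounded operator on `L²(ℝ)` with
`⟨C_Ω f, g⟩ = E_Ω(f, g)` for all `f, g` (Mathlib's inner product is linear in its second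
argument). By `existsUnique_concentrationOp` it exists and is unique for every bounded `Ω`. -/
noncomputable def concentrationOp (φ : SignalSpace) (Ω : Set (ℝ × ℝ)) :
    SignalSpace →L[ℂ] SignalSpace :=
  if h : ∃ C : SignalSpace →L[ℂ] SignalSpace,
      ∀ f g : SignalSpace, inner ℂ g (C f) = concentrationForm φ Ω f g
  then h.choose else 0

theorem concentrationOp_spec (φ : SignalSpace) {Ω : Set (ℝ × ℝ)}
    (hΩ : Bornology.IsBounded Ω) (f g : SignalSpace) :
    inner ℂ g (concentrationOp φ Ω f) = concentrationForm φ Ω f g := by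
  have h := (existsUnique_concentrationOp φ hΩ).exists
  rw [concentrationOp, dif_pos h]
  exact h.choose_spec f g

/-- The multiplicity of the real number `μ` as an eigenvalue of `C_Ω`, i.e. the (possibly
infinite) dimension of `ker (C_Ω - μ)`; it is `0` if `μ` is not an eigenvalue. -/
noncomputable def eigenvalueMultiplicity (φ : SignalSpace) (Ω : Set (ℝ × ℝ)) (μ : ℝ) : ℕ∞ :=
  Cardinal.toENat (Module.rank ℂ
    (Module.End.eigenspace (concentrationOp φ Ω : SignalSpace →ₗ[ℂ] SignalSpace) (μ : ℂ)))

/-- `n(lam, Ω)`: the number of eigenvalues `≥ lam` of `C_Ω`, counted with multiplicity. -/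
noncomputable def eigenvalueCount (φ : SignalSpace) (lam : ℝ) (Ω : Set (ℝ × ℝ)) : ℝ≥0∞ :=
  ∑' μ : Set.Ici lam, (eigenvalueMultiplicity φ Ω μ : ℝ≥0∞)

/-! Write `V` for the area of the region `Ω`, `B` for the squared Hilbert–Schmidt norm of `C_Ω`, and
`m_i` for its eigenvalues. Moyal's identity (Plancherel in frequency, Tonelli in time) gives `0 ≤
m_i ≤ 1`, and Parseval gives the trace `∑ m_i = V` and `∑ m_i² = B`. Hence `∑ m_i (1 - m_i) = V -
B`. On `[0, 1]` the indicator of `x ≥ lam` differs from `x` by at most `c x (1 - x)`, where `c = 1 /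
lam + 1 / (1 - lam)`. Summing over the spectrum, the count differs from `V` by at most `c (V - B)`.

It remains to see that `B / V → 1` under dilation. By covariance `B` is the integral over `z` of
`|S_φ φ(z)|²` times the area of `Ω ∩ (Ω - z)`. Dilating `Ω` by `r` and dividing by the dilated area
replaces `z` by `z / r` in the overlap, so the overlap ratio tends to `1`, and `|S_φ φ|²` has total
mass `1` by Moyal. The ratio therefore converges, which is more than the claim about the lower
limit.

The argument rests on `lintegral_enorm_sq_gaborTransform`, `exists_concentration_eigenbasis`,
`eigenvalueCount_bounds` and `tendsto_hilbertSchmidt_div_volume`. -/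

/-! ### Plancherel's theorem and Moyal's identity. -/

open scoped FourierTransform SchwartzMap in
/-- The Fourier transform on `L²` is given by the Fourier integral on `L¹ ∩ L²`. -/
theorem coeFn_fourier_toLp_ae_eq {h : ℝ → ℂ} (h1 : Integrable h) (h2 : MemLp h 2) :
    (𝓕 (h2.toLp h) : Lp ℂ 2 (volume : Measure ℝ)) =ᵐ[volume] 𝓕 h := by
  have hc : Continuous (𝓕 h) :=
    VectorFourier.fourierIntegral_continuous Real.continuous_fourierChar
      (by simp only [innerₗ_apply_apply]; fun_prop) h1
  -- Both sides are tested against smooth compactly supported `g`. The transform moves onto `g` by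
  -- duality of tempered distributions on the `L²` side and by Fubini on the `L¹` side.
  refine ae_eq_of_integral_contDiff_smul_eq
    ((Lp.memLp _).locallyIntegrable (by norm_num)) hc.locallyIntegrable fun g hg hgs => ?_
  have hgs' : HasCompactSupport (fun x => (g x : ℂ)) := hgs.comp_left (g := fun x : ℝ => (x : ℂ)) rfl
  have hg' : ContDiff ℝ ((⊤ : ℕ∞) : WithTop ℕ∞) (fun x => (g x : ℂ)) := Complex.ofRealCLM.contDiff.comp hg
  let G : 𝓢(ℝ, ℂ) := hgs'.toSchwartzMap hg'
  have hG : ∀ x, G x = (g x : ℂ) := fun x => rfl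
  have e1 := congrArg (fun T => T G) (Lp.fourier_toTemperedDistribution_eq (h2.toLp h))
  simp only [TemperedDistribution.fourier_apply, Lp.toTemperedDistribution_apply] at e1
  have e2 : ∫ x, (𝓕 G) x • (h2.toLp h) x = ∫ x, (𝓕 (G : ℝ → ℂ)) x • h x := by
    refine integral_congr_ae ?_
    filter_upwards [h2.coeFn_toLp] with x hx
    rw [hx, SchwartzMap.fourier_coe]
  have e3 := VectorFourier.integral_fourierIntegral_smul_eq_flip (μ := volume) (ν := volume)
    (L := innerₗ ℝ) Real.continuous_fourierChar (by simp only [innerₗ_apply_apply]; fun_prop) G.integrable h1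
  have e4 : (innerₗ ℝ).flip = innerₗ ℝ := by ext; simp
  rw [e4] at e3
  have e5 : ∫ x, (𝓕 (G : ℝ → ℂ)) x • h x = ∫ x, G x • 𝓕 h x := e3
  simp only [hG] at e1 e5
  simp only [← Complex.coe_smul, ← e1, ← e5, ← e2]

open scoped FourierTransform in
/-- Plancherel's theorem for the Fourier integral on `L¹ ∩ L²`. -/
theorem lintegral_enorm_sq_fourier {h : ℝ → ℂ} (h1 : Integrable h) (h2 : MemLp h 2) :
    ∫⁻ x, ‖𝓕 h x‖ₑ ^ 2 = ∫⁻ x, ‖h x‖ₑ ^ 2 := by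
  have key : ∀ f : ℝ → ℂ, ∫⁻ x, ‖f x‖ₑ ^ 2 = eLpNorm f 2 volume ^ 2 := fun f => by
    rw [eLpNorm_eq_lintegral_rpow_enorm_toReal two_ne_zero ENNReal.ofNat_ne_top,
      ← ENNReal.rpow_natCast, ← ENNReal.rpow_mul]
    simp
  rw [key, key, ← eLpNorm_congr_ae (coeFn_fourier_toLp_ae_eq h1 h2),
    ← eLpNorm_congr_ae h2.coeFn_toLp, ← Lp.enorm_def, ← Lp.enorm_def, enorm_eq_nnnorm,
    enorm_eq_nnnorm]
  congr 2
  exact NNReal.eq (Lp.norm_fourier_eq _)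

open scoped FourierTransform in
lemma norm_gaborTransform_eq_fourier (φ f : SignalSpace) (τ σ : ℝ) :
    ‖gaborTransform φ f (τ, σ)‖ = ‖𝓕 (fun t : ℝ => f t * conj (φ (t + τ))) σ‖ := by
  have h1 : (Real.pi * Complex.I * τ * σ : ℂ) = ((Real.pi * τ * σ : ℝ) : ℂ) * Complex.I := by
    push_cast; ring
  have h2 : gaborTransform φ f (τ, σ) = conj (Complex.exp (Real.pi * Complex.I * τ * σ)) *
      𝓕 (fun t : ℝ => f t * conj (φ (t + τ))) σ := by
    rw [gaborTransform, Real.fourier_real_eq_integral_exp_smul, ← integral_const_mul]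
    refine integral_congr_ae (Eventually.of_forall fun t => ?_)
    simp only [timeFreqShift, map_mul, smul_eq_mul]
    have h3 : conj (Complex.exp (2 * Real.pi * Complex.I * σ * t))
        = Complex.exp (((-2 * Real.pi * t * σ : ℝ) : ℂ) * Complex.I) := by
      rw [← Complex.exp_conj]
      congr 1
      simp only [map_mul, Complex.conj_ofReal, Complex.conj_I, map_ofNat]
      push_cast
      ring
    rw [h3]
    ring
  rw [h2, norm_mul, RCLike.norm_conj, h1, Complex.norm_exp_ofReal_mul_I, one_mul]

lemma SignalSpace.lintegral_enorm_sq (f : SignalSpace) :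
    ∫⁻ t, ‖f t‖ₑ ^ 2 = ‖f‖ₑ ^ 2 := by
  rw [Lp.enorm_def, eLpNorm_eq_lintegral_rpow_enorm_toReal two_ne_zero ENNReal.ofNat_ne_top,
    ← ENNReal.rpow_natCast, ← ENNReal.rpow_mul]
  simp

lemma lintegral_lintegral_enorm_sq_mul (φ f : SignalSpace) :
    ∫⁻ τ : ℝ, ∫⁻ t : ℝ, ‖f t * conj (φ (t + τ))‖ₑ ^ 2 = ‖φ‖ₑ ^ 2 * ‖f‖ₑ ^ 2 := by
  have hφ := (Lp.stronglyMeasurable φ).measurable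
  have hf := (Lp.stronglyMeasurable f).measurable
  have e : ∀ τ t : ℝ, ‖f t * conj (φ (t + τ))‖ₑ ^ 2 = ‖f t‖ₑ ^ 2 * ‖φ (t + τ)‖ₑ ^ 2 := by
    intro τ t
    rw [enorm_mul, mul_pow, RCLike.enorm_conj]
  simp_rw [e]
  rw [lintegral_lintegral_swap]
  · have : ∀ t : ℝ, ∫⁻ τ : ℝ, ‖f t‖ₑ ^ 2 * ‖φ (t + τ)‖ₑ ^ 2 = ‖f t‖ₑ ^ 2 * ‖φ‖ₑ ^ 2 := by
      intro t
      rw [lintegral_const_mul _ (by fun_prop),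
        lintegral_add_left_eq_self (fun s => ‖φ s‖ₑ ^ 2), SignalSpace.lintegral_enorm_sq]
    simp_rw [this]
    rw [lintegral_mul_const _ (by fun_prop), SignalSpace.lintegral_enorm_sq, mul_comm]
  · have h2 : Measurable fun q : ℝ × ℝ => (φ : ℝ → ℂ) (q.2 + q.1) := hφ.comp (by fun_prop)
    have h1 : Measurable fun q : ℝ × ℝ => (f : ℝ → ℂ) q.2 := hf.comp measurable_snd
    exact ((h1.enorm.pow_const 2).mul (h2.enorm.pow_const 2)).aemeasurable

lemma integrable_mul_conj_translate (φ f : SignalSpace) (τ : ℝ) :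
    Integrable fun t : ℝ => f t * conj (φ (t + τ)) :=
  (Lp.memLp f).integrable_mul
    ((Lp.memLp φ).comp_measurePreserving (measurePreserving_add_right volume τ)).star

/-- Moyal's identity: the Gabor transform is a multiple of an isometry. -/
theorem lintegral_enorm_sq_gaborTransform (φ f : SignalSpace) :
    ∫⁻ p, ‖gaborTransform φ f p‖ₑ ^ 2 = ‖φ‖ₑ ^ 2 * ‖f‖ₑ ^ 2 := by
  have hφ := (Lp.stronglyMeasurable φ).measurable
  have hf := (Lp.stronglyMeasurable f).measurable
  have hm : Measurable fun q : ℝ × ℝ => ‖f q.2 * conj (φ (q.2 + q.1))‖ₑ ^ 2 := by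
    have h2 : Measurable fun q : ℝ × ℝ => (φ : ℝ → ℂ) (q.2 + q.1) := hφ.comp (by fun_prop)
    have h1 : Measurable fun q : ℝ × ℝ => (f : ℝ → ℂ) q.2 := hf.comp measurable_snd
    exact (h1.mul (Complex.continuous_conj.measurable.comp h2)).enorm.pow_const 2
  rw [← lintegral_lintegral_enorm_sq_mul, Measure.volume_eq_prod, lintegral_prod _
    ((stronglyMeasurable_gaborTransform φ f).measurable.enorm.pow_const 2).aemeasurable]
  -- The product `f · conj φ(· + τ)` is always integrable but need not be square integrable for
  -- every `τ`; almost every `τ` is enough for slicewise Plancherel.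
  have hfin : ∀ᵐ τ : ℝ, ∫⁻ t : ℝ, ‖f t * conj (φ (t + τ))‖ₑ ^ 2 < ∞ := by
    refine ae_lt_top hm.lintegral_prod_right' ?_
    rw [lintegral_lintegral_enorm_sq_mul]
    simp [ENNReal.mul_eq_top]
  refine lintegral_congr_ae ?_
  filter_upwards [hfin] with τ hτ
  have h1 := integrable_mul_conj_translate φ f τ
  rw [← lintegral_enorm_sq_fourier h1]
  · refine lintegral_congr fun σ => ?_
    rw [← ofReal_norm, ← ofReal_norm, norm_gaborTransform_eq_fourier]
  · refine ⟨h1.1, ?_⟩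
    rw [eLpNorm_lt_top_iff_lintegral_rpow_enorm_lt_top two_ne_zero ENNReal.ofNat_ne_top]
    simpa using hτ

/-! ### Measurability and compactness of the concentration operator. -/

/-- Distinct orthonormal vectors are `√2` apart, so the balls of radius `1 / 2` around them are
disjoint. Countability is what later allows sums over a basis to be exchanged with integrals. -/
theorem Orthonormal.countable_index {ι E : Type*} [NormedAddCommGroup E] [InnerProductSpace ℂ E]
    [TopologicalSpace.SeparableSpace E] {v : ι → E} (hv : Orthonormal ℂ v) : Countable ι := by
  refine Pairwise.countable_of_isOpen_disjoint (s := fun i => Metric.ball (v i) (1 / 2))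
    (fun i j hij => Metric.ball_disjoint_ball ?_) (fun i => Metric.isOpen_ball)
    (fun i => Metric.nonempty_ball.2 (by norm_num))
  have h := norm_sub_sq (𝕜 := ℂ) (v i) (v j)
  rw [hv.1, hv.1, hv.2 hij] at h
  norm_num at h
  rw [dist_eq_norm]
  nlinarith [norm_nonneg (v i - v j)]

instance : TopologicalSpace.SeparableSpace SignalSpace := by
  have : Fact ((2 : ℝ≥0∞) ≠ ∞) := ⟨by norm_num⟩
  infer_instance

/-- A weakly measurable function with values in a separable Hilbert space is strongly measurable. -/
theorem stronglyMeasurable_of_forall_inner {α E : Type*} [MeasurableSpace α]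
    [NormedAddCommGroup E] [InnerProductSpace ℂ E] [CompleteSpace E]
    [TopologicalSpace.SeparableSpace E] {F : α → E}
    (h : ∀ x : E, StronglyMeasurable fun a => (inner ℂ x (F a) : ℂ)) : StronglyMeasurable F := by
  obtain ⟨w, b, hb⟩ := exists_hilbertBasis ℂ E
  have hw : Countable w := b.orthonormal.countable_index
  refine stronglyMeasurable_of_tendsto (u := atTop)
    (f := fun (s : Finset w) a => ∑ i ∈ s, (inner ℂ (b i) (F a) : ℂ) • b i) (fun s => ?_) ?_
  · exact Finset.stronglyMeasurable_fun_sum _ fun i _ => (h (b i)).smul_const (b i)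
  · refine tendsto_pi_nhds.2 fun a => ?_
    have := b.hasSum_repr (F a)
    simpa only [HilbertBasis.repr_apply_apply, HasSum,
      SummationFilter.unconditional_filter] using this

lemma stronglyMeasurable_shiftLp (φ : SignalSpace) : StronglyMeasurable (shiftLp φ) := by
  refine stronglyMeasurable_of_forall_inner fun x => ?_
  have := Complex.continuous_conj.comp_stronglyMeasurable (stronglyMeasurable_gaborTransform φ x)
  simpa only [Function.comp_def, gaborTransform_eq_inner, inner_conj_symm] using this

lemma isCompactOperator_rankOne {E : Type*} [NormedAddCommGroup E] [InnerProductSpace ℂ E]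
    (x y : E) : IsCompactOperator (InnerProductSpace.rankOne ℂ x y : E →L[ℂ] E) := by
  have h : IsCompactOperator (id : ℂ → ℂ) :=
    (isCompactOperator_id_iff_finiteDimensional (𝕜 := ℂ)).2 inferInstance
  exact (h.clm_comp (ContinuousLinearMap.toSpanSingleton ℂ x)).comp_clm (innerSL ℂ y)

/-- The quotient map commutes with the integral and kills every value of `F`. Closedness makes the
quotient a normed space. -/
theorem Submodule.integral_mem_of_isClosed {α X : Type*} [MeasurableSpace α] {μ : Measure α}
    [NormedAddCommGroup X] [NormedSpace ℂ X] [CompleteSpace X] (V : Submodule ℂ X)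
    [hV : IsClosed (V : Set X)] {F : α → X} (hF : Integrable F μ) (hc : ∀ a, F a ∈ V) :
    ∫ a, F a ∂μ ∈ V := by
  let π : X →L[ℂ] X ⧸ V := V.mkQL
  have h : π (∫ a, F a ∂μ) = 0 := by
    rw [← π.integral_comp_comm hF]
    exact integral_eq_zero_of_ae (Eventually.of_forall fun a =>
      (Submodule.Quotient.mk_eq_zero V).2 (hc a))
  exact (Submodule.Quotient.mk_eq_zero V).1 h

theorem isCompactOperator_integral {α E : Type*} [MeasurableSpace α] {μ : Measure α}
    [NormedAddCommGroup E] [NormedSpace ℂ E] [CompleteSpace E] {F : α → E →L[ℂ] E}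
    (hF : Integrable F μ) (hc : ∀ a, IsCompactOperator (F a)) :
    IsCompactOperator (∫ a, F a ∂μ : E →L[ℂ] E) :=
  Submodule.integral_mem_of_isClosed (compactOperator (RingHom.id ℂ) E E)
    (hV := isClosed_setOfPred_isCompactOperator) hF hc

/-- `C_Ω` is the Bochner integral over `Ω` of the rank-one operators attached to the shifts of `φ`,
and compact operators form a closed subspace. -/
theorem isCompactOperator_concentrationOp (φ : SignalSpace) {Ω : Set (ℝ × ℝ)}
    (hΩ : Bornology.IsBounded Ω) : IsCompactOperator (concentrationOp φ Ω) := by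
  let F : ℝ × ℝ → SignalSpace →L[ℂ] SignalSpace :=
    fun p => InnerProductSpace.rankOne ℂ (shiftLp φ p) (shiftLp φ p)
  have hm : StronglyMeasurable F := by
    have : Continuous fun x : SignalSpace =>
      (InnerProductSpace.rankOne ℂ x x : SignalSpace →L[ℂ] SignalSpace) :=
      ((ContinuousLinearMap.smulRightL ℂ SignalSpace SignalSpace).continuous.comp
        (innerSL ℂ).continuous).clm_apply continuous_id
    exact this.comp_stronglyMeasurable (stronglyMeasurable_shiftLp φ)
  have hi : IntegrableOn F Ω := by
    refine IntegrableOn.of_bound hΩ.measure_lt_top hm.aestronglyMeasurable (‖φ‖ * ‖φ‖)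
      (Eventually.of_forall fun p => ?_)
    simp [F, norm_shiftLp]
  have he : concentrationOp φ Ω = ∫ p in Ω, F p := by
    ext1 f
    refine ext_inner_left ℂ fun g => ?_
    rw [concentrationOp_spec φ hΩ, ContinuousLinearMap.integral_apply hi,
      ← integral_inner (hi.apply_continuousLinearMap f), concentrationForm]
    refine integral_congr_ae (Eventually.of_forall fun p => ?_)
    simp [F, gaborTransform_eq_inner, inner_smul_right]
  rw [he]
  exact isCompactOperator_integral hi fun p => isCompactOperator_rankOne _ _

/-! ### Spectral decomposition and the first two moments of the eigenvalues. -/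

lemma isSymmetric_concentrationOp (φ : SignalSpace) {Ω : Set (ℝ × ℝ)}
    (hΩ : Bornology.IsBounded Ω) :
    (concentrationOp φ Ω : SignalSpace →ₗ[ℂ] SignalSpace).IsSymmetric := by
  intro f g
  rw [← inner_conj_symm]
  simp only [ContinuousLinearMap.coe_coe, concentrationOp_spec φ hΩ, concentrationForm_conj]

lemma inner_self_concentrationOp (φ : SignalSpace) {Ω : Set (ℝ × ℝ)}
    (hΩ : Bornology.IsBounded Ω) (f : SignalSpace) :
    inner ℂ f (concentrationOp φ Ω f) =
      ((∫⁻ p in Ω, ‖gaborTransform φ f p‖ₑ ^ 2).toReal : ℂ) := by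
  rw [concentrationOp_spec φ hΩ, concentrationForm]
  have h : ∀ p, gaborTransform φ f p * conj (gaborTransform φ f p)
      = ((‖gaborTransform φ f p‖ ^ 2 : ℝ) : ℂ) := fun p => by
    rw [RCLike.mul_conj]; norm_cast
  simp_rw [h]
  rw [integral_complex_ofReal, integral_eq_lintegral_of_nonneg_ae
    (Eventually.of_forall fun p => by positivity)
    (by exact ((stronglyMeasurable_gaborTransform φ f).norm.pow 2).aestronglyMeasurable)]
  congr 3
  refine funext fun p => ?_
  rw [ENNReal.ofReal_pow (norm_nonneg _), ofReal_norm]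

open Module.End in
/-- A compact self-adjoint operator has a Hilbert basis of eigenvectors, and the number of basis
vectors belonging to a nonzero eigenvalue is its multiplicity. -/
theorem exists_hilbertBasis_eigenvectors.{u} {E : Type u} [NormedAddCommGroup E]
    [InnerProductSpace ℂ E] [CompleteSpace E] {T : E →L[ℂ] E} (hc : IsCompactOperator T)
    (hs : (T : E →ₗ[ℂ] E).IsSymmetric) :
    ∃ (κ : ℝ → Type u) (b : HilbertBasis (Σ ν, κ ν) ℂ E), (∀ i, T (b i) = (i.1 : ℂ) • b i) ∧
      ∀ ν : ℝ, ν ≠ 0 →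
        Cardinal.toENat (Module.rank ℂ (eigenspace (T : E →ₗ[ℂ] E) (ν : ℂ))) = ENat.card (κ ν) := by
  have hcl : ∀ ν : ℝ, CompleteSpace (eigenspace (T : E →ₗ[ℂ] E) (ν : ℂ)) := fun ν => by
    have : IsClosed (eigenspace (T : E →ₗ[ℂ] E) (ν : ℂ) : Set E) := by
      have : (eigenspace (T : E →ₗ[ℂ] E) (ν : ℂ) : Set E) = {x | T x = (ν : ℂ) • x} := by
        ext x
        exact mem_eigenspace_iff
      rw [this]
      exact isClosed_eq T.continuous (continuous_const_smul _)
    exact this.completeSpace_coe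
  choose κ b hb using fun ν : ℝ => exists_hilbertBasis ℂ (eigenspace (T : E →ₗ[ℂ] E) (ν : ℂ))
  have hof : OrthogonalFamily ℂ (fun ν : ℝ => eigenspace (T : E →ₗ[ℂ] E) (ν : ℂ))
      fun ν => (eigenspace (T : E →ₗ[ℂ] E) (ν : ℂ)).subtypeₗᵢ :=
    hs.orthogonalFamily_eigenspaces.comp Complex.ofReal_injective
  have hon : Orthonormal ℂ fun i : Σ ν, κ ν => (b i.1 i.2 : E) :=
    hof.orthonormal_sigma_orthonormal (v_family := fun ν => b ν) fun ν => (b ν).orthonormal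
  -- A vector orthogonal to all chosen basis vectors is orthogonal to every eigenspace, hence zero
  -- by the spectral theorem. That theorem runs over complex `μ`; symmetry makes the eigenvalues
  -- real.
  have hbot : (Submodule.span ℂ (Set.range fun i : Σ ν, κ ν => (b i.1 i.2 : E)))ᗮ = ⊥ := by
    rw [eq_bot_iff, ← ContinuousLinearMap.orthogonalComplement_iSup_eigenspaces_eq_bot hc hs]
    intro x hx
    rw [← Submodule.iInf_orthogonal, Submodule.mem_iInf]
    intro μ
    by_cases hμ : eigenspace (T : E →ₗ[ℂ] E) μ = ⊥
    · rw [hμ]; simp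
    obtain ⟨ν, rfl⟩ : ∃ ν : ℝ, (ν : ℂ) = μ :=
      Complex.conj_eq_iff_real.1 (hs.conj_eigenvalue_eq_self (hasEigenvalue_iff.2 hμ)) |>.imp
        fun _ h => h.symm
    intro y hy
    have h1 := (b ν).hasSum_repr ⟨y, hy⟩
    have h2 := (h1.mapL (eigenspace (T : E →ₗ[ℂ] E) (ν : ℂ)).subtypeL).mapL (innerSL ℂ x)
    have h3 : ∀ i : κ ν, (inner ℂ x (b ν i : E) : ℂ) = 0 := fun i => by
      rw [← inner_conj_symm, hx _ (Submodule.subset_span ⟨⟨ν, i⟩, rfl⟩), map_zero]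
    simp only [map_smul, Submodule.subtypeL_apply, innerSL_apply_apply, h3, smul_zero] at h2
    rw [← inner_conj_symm, h2.unique hasSum_zero, map_zero]
  refine ⟨fun ν => κ ν, HilbertBasis.mkOfOrthogonalEqBot hon hbot, fun i => ?_, fun ν hν => ?_⟩
  · rw [HilbertBasis.coe_mkOfOrthogonalEqBot]
    exact mem_eigenspace_iff.1 (b i.1 i.2).2
  -- For `ν ≠ 0` compactness makes the eigenspace finite-dimensional, so its Hilbert basis is a
  -- vector-space basis.
  · have hfd : FiniteDimensional ℂ (eigenspace (T : E →ₗ[ℂ] E) (ν : ℂ)) :=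
      ContinuousLinearMap.finite_dimensional_eigenspace hc _ (by exact_mod_cast hν)
    have : Finite (κ ν) := (b ν).orthonormal.linearIndependent.finite
    have := Fintype.ofFinite (κ ν)
    rw [← Module.finrank_eq_rank, Module.finrank_eq_card_basis (b ν).toOrthonormalBasis.toBasis,
      ENat.card_eq_coe_fintype_card]
    simp

lemma HilbertBasis.tsum_enorm_inner_sq {ι E : Type*} [NormedAddCommGroup E]
    [InnerProductSpace ℂ E] (b : HilbertBasis ι ℂ E) (x : E) :
    ∑' i, ‖(inner ℂ x (b i) : ℂ)‖ₑ ^ 2 = ‖x‖ₑ ^ 2 := by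
  have h := b.hasSum_inner_mul_inner x x
  have h' : HasSum (fun i => ‖(inner ℂ x (b i) : ℂ)‖ ^ 2) (‖x‖ ^ 2) := by
    have e1 : ∀ i, ((‖(inner ℂ x (b i) : ℂ)‖ ^ 2 : ℝ) : ℂ)
        = inner ℂ x (b i) * inner ℂ (b i) x := fun i => by
      rw [← inner_conj_symm (b i) x, RCLike.mul_conj]
      norm_cast
    have e2 : ((‖x‖ ^ 2 : ℝ) : ℂ) = inner ℂ x x := by
      rw [inner_self_eq_norm_sq_to_K]
      norm_cast
    rw [← Complex.hasSum_ofReal]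
    simp_rw [e1, e2]
    exact h
  have h2 := ENNReal.ofReal_tsum_of_nonneg (fun i => by positivity) h'.summable
  rw [h'.tsum_eq] at h2
  simpa [ENNReal.ofReal_pow, ofReal_norm] using h2.symm

/-- Parseval for `⟨x, T x⟩`, with `T` moved onto the eigenvectors by symmetry. The extended
nonnegative form lets the sum be exchanged with integrals by Tonelli. -/
lemma HilbertBasis.tsum_mul_enorm_inner_sq {ι E : Type*} [NormedAddCommGroup E]
    [InnerProductSpace ℂ E] (b : HilbertBasis ι ℂ E) {T : E →L[ℂ] E}
    (hs : (T : E →ₗ[ℂ] E).IsSymmetric) {ν : ι → ℝ} (hν : ∀ i, 0 ≤ ν i)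
    (hb : ∀ i, T (b i) = (ν i : ℂ) • b i) {x : E} {a : ℝ} (ha : inner ℂ x (T x) = (a : ℂ)) :
    ∑' i, ENNReal.ofReal (ν i) * ‖(inner ℂ x (b i) : ℂ)‖ₑ ^ 2 = ENNReal.ofReal a := by
  have h := b.hasSum_inner_mul_inner x (T x)
  have h' : HasSum (fun i => ν i * ‖(inner ℂ x (b i) : ℂ)‖ ^ 2) a := by
    have e1 : ∀ i, ((ν i * ‖(inner ℂ x (b i) : ℂ)‖ ^ 2 : ℝ) : ℂ)
        = inner ℂ x (b i) * inner ℂ (b i) (T x) := fun i => by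
      have e : inner ℂ (b i) (T x) = inner ℂ (T (b i)) x := (hs (b i) x).symm
      rw [e, hb, inner_smul_left, Complex.conj_ofReal, ← inner_conj_symm (b i) x, mul_left_comm,
        RCLike.mul_conj]
      push_cast
      rfl
    rw [← Complex.hasSum_ofReal, ← ha]
    simp_rw [e1]
    exact h
  have h2 := ENNReal.ofReal_tsum_of_nonneg (fun i => mul_nonneg (hν i) (by positivity)) h'.summable
  rw [h'.tsum_eq] at h2
  simpa [ENNReal.ofReal_mul, hν, ENNReal.ofReal_pow, ofReal_norm] using h2.symm

/-- The eigenvalues of the concentration operator, as the energies of a Hilbert basis of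
eigenvectors. -/
theorem exists_concentration_eigenbasis (φ : SignalSpace) (hφ : ‖φ‖ = 1) {Ω : Set (ℝ × ℝ)}
    (hΩ : Bornology.IsBounded Ω) {lam : ℝ} (hlam : 0 < lam) :
    ∃ (ι : Type) (m : ι → ℝ≥0∞), (∀ i, m i ≤ 1) ∧ ∑' i, m i = volume Ω ∧
      ∑' i, m i ^ 2 = ∫⁻ p in Ω, ∫⁻ q in Ω, ‖gaborTransform φ (shiftLp φ p) q‖ₑ ^ 2 ∧
      eigenvalueCount φ lam Ω = ∑' i, {i | ENNReal.ofReal lam ≤ m i}.indicator 1 i := by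
  have hs := isSymmetric_concentrationOp φ hΩ
  have hφ' : ‖φ‖ₑ = 1 := by rw [← ofReal_norm, hφ, ENNReal.ofReal_one]
  obtain ⟨κ, b, hb, hκ⟩ :=
    exists_hilbertBasis_eigenvectors (isCompactOperator_concentrationOp φ hΩ) hs
  have hcount : Countable (Σ ν, κ ν) := b.orthonormal.countable_index
  -- The energy of an eigenvector inside `Ω` is its eigenvalue, since it equals `⟨b i, C_Ω (b i)⟩`.
  let m : (Σ ν, κ ν) → ℝ≥0∞ := fun i => ∫⁻ p in Ω, ‖gaborTransform φ (b i) p‖ₑ ^ 2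
  have hm1 : ∀ i, m i ≤ 1 := fun i => by
    refine (setLIntegral_le_lintegral _ _).trans ?_
    rw [lintegral_enorm_sq_gaborTransform, hφ', ← ofReal_norm, b.orthonormal.1 i]
    simp
  have hm : ∀ i, i.1 = (m i).toReal := fun i => by
    have h := inner_self_concentrationOp φ hΩ (b i)
    rw [hb, inner_smul_right, inner_self_eq_norm_sq_to_K, b.orthonormal.1 i] at h
    simpa [Complex.ofReal_inj] using h
  have hm' : ∀ i, ENNReal.ofReal i.1 = m i := fun i => by
    rw [hm, ENNReal.ofReal_toReal ((hm1 i).trans_lt ENNReal.one_lt_top).ne]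
  have hmeas : ∀ f : SignalSpace, Measurable fun p => ‖gaborTransform φ f p‖ₑ ^ 2 := fun f =>
    (stronglyMeasurable_gaborTransform φ f).measurable.enorm.pow_const 2
  refine ⟨_, m, hm1, ?_, ?_, ?_⟩
  -- Trace: by Parseval the integrand sums to the squared norm of the shifted window, which is `1`.
  · rw [← lintegral_tsum fun i => (hmeas (b i)).aemeasurable]
    simp_rw [gaborTransform_eq_inner, b.tsum_enorm_inner_sq]
    simp [← ofReal_norm, norm_shiftLp, hφ]
  -- One factor `m i` stays as the eigenvalue and the other is unfolded into an integral. The sum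
  -- over `i` is then the quadratic form of `C_Ω` at the shifted window.
  · have h : ∀ i, m i ^ 2 = ∫⁻ p in Ω, m i * ‖gaborTransform φ (b i) p‖ₑ ^ 2 := fun i => by
      rw [lintegral_const_mul _ (hmeas (b i)), sq]
    simp_rw [h]
    rw [← lintegral_tsum fun i => ((hmeas (b i)).const_mul _).aemeasurable]
    refine lintegral_congr fun p => ?_
    simp_rw [gaborTransform_eq_inner φ (b _), ← hm']
    rw [b.tsum_mul_enorm_inner_sq hs (ν := fun i => i.1) (fun i => by simp [hm]) hb
      (inner_self_concentrationOp φ hΩ (shiftLp φ p)), ENNReal.ofReal_toReal]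
    refine ((setLIntegral_le_lintegral _ _).trans_lt ?_).ne
    rw [lintegral_enorm_sq_gaborTransform]
    simp [ENNReal.mul_lt_top_iff]
  · have h : ∀ i, ENNReal.ofReal lam ≤ m i ↔ lam ≤ i.1 := fun i => by
      rw [← hm', ENNReal.ofReal_le_ofReal_iff (by simp [hm])]
    simp_rw [h]
    rw [ENNReal.tsum_sigma', eigenvalueCount,
      tsum_subtype (Set.Ici lam) fun ν => (eigenvalueMultiplicity φ Ω ν : ℝ≥0∞)]
    refine tsum_congr fun ν => ?_
    by_cases hν : lam ≤ ν
    · rw [Set.indicator_of_mem (show ν ∈ Set.Ici lam from hν), eigenvalueMultiplicity,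
        hκ ν (hlam.trans_le hν).ne']
      simp [Set.indicator, hν]
    · simp [Set.indicator, hν]

/-! ### Counting eigenvalues from the two moments. -/

/-- If `m ≥ lam` then `1 - m ≤ m (1 - m) / lam`; if `m < lam` then `m ≤ m (1 - m) / (1 - lam)`. The
sum of the two constants serves both cases, and the terms are arranged to avoid truncated
subtraction. -/
lemma indicator_add_mul_sq_le {lam : ℝ} (h0 : 0 < lam) (h1 : lam < 1) {m : ℝ≥0∞} (hm : m ≤ 1) :
    {x | ENNReal.ofReal lam ≤ x}.indicator 1 m + ENNReal.ofReal (1 / lam + 1 / (1 - lam)) * m ^ 2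
        ≤ m + ENNReal.ofReal (1 / lam + 1 / (1 - lam)) * m ∧
      m + ENNReal.ofReal (1 / lam + 1 / (1 - lam)) * m ^ 2
        ≤ {x | ENNReal.ofReal lam ≤ x}.indicator 1 m
          + ENNReal.ofReal (1 / lam + 1 / (1 - lam)) * m := by
  lift m to NNReal using (hm.trans_lt ENNReal.one_lt_top).ne
  obtain ⟨x, hx, e⟩ : ∃ x : ℝ, 0 ≤ x ∧ (m : ℝ≥0∞) = ENNReal.ofReal x :=
    ⟨m, m.2, (ENNReal.ofReal_coe_nnreal).symm⟩
  rw [e] at hm ⊢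
  have hx1 : x ≤ 1 := by
    rw [← ENNReal.ofReal_one] at hm
    exact (ENNReal.ofReal_le_ofReal_iff zero_le_one).1 hm
  have hl1 : 0 < 1 - lam := sub_pos.2 h1
  have a1 : 0 ≤ 1 / lam := by positivity
  have a2 : 0 ≤ 1 / (1 - lam) := by positivity
  have b1 : 1 / lam * lam = 1 := one_div_mul_cancel h0.ne'
  have b2 : 1 / (1 - lam) * (1 - lam) = 1 := one_div_mul_cancel hl1.ne'
  set u := 1 / lam
  set v := 1 / (1 - lam)
  have hxx : 0 ≤ x * (1 - x) := mul_nonneg hx (by linarith)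
  have hite : {x | ENNReal.ofReal lam ≤ x}.indicator (1 : ℝ≥0∞ → ℝ≥0∞) (ENNReal.ofReal x)
      = ENNReal.ofReal (if lam ≤ x then 1 else 0) := by
    simp only [Set.indicator, Set.mem_ofPred_eq, ENNReal.ofReal_le_ofReal_iff hx, Pi.one_apply]
    split_ifs <;> simp
  have hnn : (0 : ℝ) ≤ if lam ≤ x then 1 else 0 := by split_ifs <;> norm_num
  rw [hite, ← ENNReal.ofReal_pow hx, ← ENNReal.ofReal_mul (by positivity),
    ← ENNReal.ofReal_mul (by positivity), ← ENNReal.ofReal_add hnn (by positivity),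
    ← ENNReal.ofReal_add hx (by positivity), ← ENNReal.ofReal_add hx (by positivity),
    ← ENNReal.ofReal_add hnn (by positivity)]
  constructor <;> refine ENNReal.ofReal_le_ofReal ?_ <;> split_ifs with h
  · have : 0 ≤ u * (x - lam) * (1 - x) :=
      mul_nonneg (mul_nonneg a1 (by linarith)) (by linarith)
    nlinarith [mul_nonneg a2 hxx]
  · nlinarith [mul_nonneg a2 hxx, mul_nonneg a1 hxx]
  · nlinarith [mul_nonneg a2 hxx, mul_nonneg a1 hxx]
  · have : 0 ≤ v * (lam - x) * x := mul_nonneg (mul_nonneg a2 (by linarith)) hx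
    nlinarith [mul_nonneg a1 hxx]

/-- The eigenvalue count differs from the area of `Ω` by at most a multiple of the area minus
the Hilbert–Schmidt norm squared. -/
theorem eigenvalueCount_bounds (φ : SignalSpace) (hφ : ‖φ‖ = 1) {Ω : Set (ℝ × ℝ)}
    (hΩ : Bornology.IsBounded Ω) {lam : ℝ} (h0 : 0 < lam) (h1 : lam < 1) :
    eigenvalueCount φ lam Ω + ENNReal.ofReal (1 / lam + 1 / (1 - lam)) *
        ∫⁻ p in Ω, ∫⁻ q in Ω, ‖gaborTransform φ (shiftLp φ p) q‖ₑ ^ 2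
        ≤ volume Ω + ENNReal.ofReal (1 / lam + 1 / (1 - lam)) * volume Ω ∧
      volume Ω + ENNReal.ofReal (1 / lam + 1 / (1 - lam)) *
        ∫⁻ p in Ω, ∫⁻ q in Ω, ‖gaborTransform φ (shiftLp φ p) q‖ₑ ^ 2
        ≤ eigenvalueCount φ lam Ω + ENNReal.ofReal (1 / lam + 1 / (1 - lam)) * volume Ω := by
  obtain ⟨ι, m, hm1, hA, hB, hn⟩ := exists_concentration_eigenbasis φ hφ hΩ h0
  rw [← hA, ← hB, hn]
  simp only [← ENNReal.tsum_mul_left, ← ENNReal.tsum_add]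
  exact ⟨ENNReal.tsum_le_tsum fun i => (indicator_add_mul_sq_le h0 h1 (hm1 i)).1,
    ENNReal.tsum_le_tsum fun i => (indicator_add_mul_sq_le h0 h1 (hm1 i)).2⟩

/-! ### Asymptotics of the Hilbert–Schmidt norm under dilation. -/

/-- Covariance: time-frequency shifts compose up to a unimodular phase, which the norm discards. -/
lemma norm_gaborTransform_shiftLp (φ : SignalSpace) (p q : ℝ × ℝ) :
    ‖gaborTransform φ (shiftLp φ p) q‖ = ‖gaborTransform φ φ (q - p)‖ := by
  obtain ⟨τ, σ⟩ := p
  obtain ⟨τ', σ'⟩ := q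
  have h1 : gaborTransform φ (shiftLp φ (τ, σ)) (τ', σ')
      = ∫ t : ℝ, timeFreqShift τ σ φ t * conj (timeFreqShift τ' σ' φ t) := by
    refine integral_congr_ae ?_
    filter_upwards [(memLp_timeFreqShift τ σ φ).coeFn_toLp] with t ht
    simp only [shiftLp, ht]
  have h2 : ∃ θ : ℝ, ∀ t : ℝ, timeFreqShift τ σ φ (t - τ) * conj (timeFreqShift τ' σ' φ (t - τ))
      = Complex.exp (θ * Complex.I) * (φ t * conj (timeFreqShift (τ' - τ) (σ' - σ) φ t)) := by
    refine ⟨Real.pi * τ * σ - 2 * Real.pi * σ * τ - Real.pi * τ' * σ' + 2 * Real.pi * σ' * τ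
      + Real.pi * (τ' - τ) * (σ' - σ), fun t => ?_⟩
    simp only [timeFreqShift, map_mul, ← Complex.exp_conj, Complex.conj_ofReal, Complex.conj_I,
      map_ofNat, sub_add_cancel]
    have e : t - τ + τ' = t + (τ' - τ) := by ring
    rw [e]
    have e2 : ∀ A B C D E F G x y : ℂ, Complex.exp (A + B + C + D) = Complex.exp (E + F + G) →
        Complex.exp A * Complex.exp B * x * (Complex.exp C * Complex.exp D * y)
          = Complex.exp E * (x * (Complex.exp F * Complex.exp G * y)) := by
      intro A B C D E F G x y h
      simp only [Complex.exp_add] at h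
      linear_combination x * y * h
    apply e2
    congr 1
    push_cast
    ring
  obtain ⟨θ, hθ⟩ := h2
  rw [h1, ← integral_sub_right_eq_self _ τ]
  simp_rw [hθ]
  rw [integral_const_mul, norm_mul, Complex.norm_exp_ofReal_mul_I, one_mul]
  rfl

lemma tendsto_volume_inter_translate {Ω : Set (ℝ × ℝ)} (hbdd : Bornology.IsBounded Ω)
    (hmeas : MeasurableSet Ω) (z : ℝ × ℝ) :
    Tendsto (fun r : ℝ => volume (Ω ∩ (fun p => p + r⁻¹ • z) ⁻¹' Ω)) atTop (nhds (volume Ω)) := by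
  -- Continuity of translation in measure is applied to maps converging in the compact-open
  -- topology; currying a jointly continuous map supplies that convergence.
  let f : ℝ → C(ℝ × ℝ, ℝ × ℝ) := fun r => ⟨fun p => p + r⁻¹ • z, by fun_prop⟩
  have hf : Tendsto f atTop (nhds (ContinuousMap.id _)) := by
    let g : C(ℝ, C(ℝ × ℝ, ℝ × ℝ)) := ContinuousMap.curry ⟨fun x : ℝ × (ℝ × ℝ) => x.2 + x.1 • z,
      by fun_prop⟩
    have hg : g 0 = ContinuousMap.id _ := by ext <;> simp [g]
    rw [← hg]
    exact (g.continuous.tendsto 0).comp tendsto_inv_atTop_zero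
  have h := tendsto_measure_symmDiff_preimage_nhds_zero (μ := volume) (ν := volume) hf
    (Eventually.of_forall fun r => measurePreserving_add_right volume (r⁻¹ • z))
    (MeasurePreserving.id _) hmeas.nullMeasurableSet hbdd.measure_lt_top.ne
  have h2 : Tendsto (fun r => volume Ω - volume (symmDiff (f r ⁻¹' Ω) Ω)) atTop
      (nhds (volume Ω - 0)) :=
    ENNReal.Tendsto.sub tendsto_const_nhds h (Or.inl hbdd.measure_lt_top.ne)
  rw [tsub_zero] at h2
  refine tendsto_of_tendsto_of_tendsto_of_le_of_le h2 tendsto_const_nhds (fun r => ?_)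
    fun r => measure_mono Set.inter_subset_left
  refine tsub_le_iff_right.2 ((measure_mono ?_).trans (measure_union_le _ _))
  intro p hp
  by_cases hpr : p + r⁻¹ • z ∈ Ω
  · exact Or.inl ⟨hp, hpr⟩
  · exact Or.inr (Or.inr ⟨hp, hpr⟩)

/-- Substitute `q = p + z`: the kernel depends on `z` alone, and integrating first in `p` leaves the
overlap area. -/
lemma lintegral_lintegral_enorm_sq_shiftLp (φ : SignalSpace) {Ω : Set (ℝ × ℝ)}
    (hmeas : MeasurableSet Ω) :
    ∫⁻ p in Ω, ∫⁻ q in Ω, ‖gaborTransform φ (shiftLp φ p) q‖ₑ ^ 2 =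
      ∫⁻ z, ‖gaborTransform φ φ z‖ₑ ^ 2 * volume (Ω ∩ (fun p => p + z) ⁻¹' Ω) := by
  have hk : Measurable fun z => ‖gaborTransform φ φ z‖ₑ ^ 2 :=
    (stronglyMeasurable_gaborTransform φ φ).measurable.enorm.pow_const 2
  have h1 : ∀ p, ∫⁻ q in Ω, ‖gaborTransform φ (shiftLp φ p) q‖ₑ ^ 2
      = ∫⁻ z, ‖gaborTransform φ φ z‖ₑ ^ 2 * Ω.indicator 1 (p + z) := fun p => by
    rw [← lintegral_indicator hmeas, ← lintegral_add_left_eq_self _ p]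
    refine lintegral_congr fun z => ?_
    by_cases hz : p + z ∈ Ω
    · simp [hz, ← ofReal_norm, norm_gaborTransform_shiftLp]
    · simp [hz]
  simp_rw [h1]
  have hi : Measurable (Ω.indicator (1 : ℝ × ℝ → ℝ≥0∞)) := measurable_one.indicator hmeas
  rw [lintegral_lintegral_swap]
  · refine lintegral_congr fun z => ?_
    have hz : Measurable fun p : ℝ × ℝ => p + z := measurable_add_const z
    rw [lintegral_const_mul _ (show Measurable fun p => Ω.indicator 1 (p + z) from hi.comp hz)]
    congr 1
    have : ∀ p : ℝ × ℝ, Ω.indicator (1 : ℝ × ℝ → ℝ≥0∞) (p + z)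
      = ((fun p => p + z) ⁻¹' Ω).indicator 1 p := fun p => rfl
    simp_rw [this]
    rw [lintegral_indicator_one (hz hmeas), Measure.restrict_apply (hz hmeas), Set.inter_comm]
  · exact ((hk.comp measurable_snd).mul (hi.comp (by fun_prop))).aemeasurable

lemma volume_smul_inter_translate {r : ℝ} (hr : 0 < r) (Ω : Set (ℝ × ℝ)) (z : ℝ × ℝ) :
    volume ((r • Ω) ∩ (fun p => p + z) ⁻¹' (r • Ω)) =
      ENNReal.ofReal (r ^ 2) * volume (Ω ∩ (fun p => p + r⁻¹ • z) ⁻¹' Ω) := by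
  have : (r • Ω) ∩ (fun p => p + z) ⁻¹' (r • Ω) = r • (Ω ∩ (fun p => p + r⁻¹ • z) ⁻¹' Ω) := by
    ext p
    simp [Set.mem_smul_set_iff_inv_smul_mem₀ hr.ne']
  rw [this, Measure.addHaar_smul]
  simp [abs_of_pos hr]

lemma volume_smul_set {r : ℝ} (hr : 0 < r) (Ω : Set (ℝ × ℝ)) :
    volume (r • Ω) = ENNReal.ofReal (r ^ 2) * volume Ω := by
  rw [Measure.addHaar_smul]
  simp [abs_of_pos hr]

/-- The factors `r²` cancel, leaving an integral dominated by `|S_φ φ|²` times the area of `Ω`;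
Moyal's identity makes this bound integrable and evaluates the limit. -/
theorem tendsto_hilbertSchmidt_div_volume (φ : SignalSpace) (hφ : ‖φ‖ = 1) {Ω : Set (ℝ × ℝ)}
    (hbdd : Bornology.IsBounded Ω) (hmeas : MeasurableSet Ω) (hpos : 0 < volume Ω) :
    Tendsto (fun r : ℝ => (∫⁻ p in r • Ω, ∫⁻ q in r • Ω,
      ‖gaborTransform φ (shiftLp φ p) q‖ₑ ^ 2) / volume (r • Ω)) atTop (nhds 1) := by
  have hφ' : ‖φ‖ₑ = 1 := by rw [← ofReal_norm, hφ, ENNReal.ofReal_one]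
  have hk : Measurable fun z => ‖gaborTransform φ φ z‖ₑ ^ 2 :=
    (stronglyMeasurable_gaborTransform φ φ).measurable.enorm.pow_const 2
  have hk1 : ∫⁻ z, ‖gaborTransform φ φ z‖ₑ ^ 2 = 1 := by
    rw [lintegral_enorm_sq_gaborTransform, hφ']
    simp
  have hfin := hbdd.measure_lt_top (μ := volume)
  have hg : ∀ r : ℝ, Measurable fun z : ℝ × ℝ => volume (Ω ∩ (fun p => p + r⁻¹ • z) ⁻¹' Ω) := by
    intro r
    have hS : MeasurableSet {x : (ℝ × ℝ) × (ℝ × ℝ) | x.2 ∈ Ω ∧ x.2 + r⁻¹ • x.1 ∈ Ω} :=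
      (measurable_snd hmeas).inter
        ((show Measurable fun x : (ℝ × ℝ) × (ℝ × ℝ) => x.2 + r⁻¹ • x.1 by fun_prop) hmeas)
    exact measurable_measure_prodMk_left hS
  have hlim : Tendsto (fun r : ℝ => ∫⁻ z, ‖gaborTransform φ φ z‖ₑ ^ 2 *
      volume (Ω ∩ (fun p => p + r⁻¹ • z) ⁻¹' Ω)) atTop (nhds (volume Ω)) := by
    have e : volume Ω = ∫⁻ z, ‖gaborTransform φ φ z‖ₑ ^ 2 * volume Ω := by
      rw [lintegral_mul_const _ hk, hk1, one_mul]
    conv => arg 3; rw [e]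
    refine tendsto_lintegral_filter_of_dominated_convergence
      (fun z => ‖gaborTransform φ φ z‖ₑ ^ 2 * volume Ω)
      (Eventually.of_forall fun r => hk.mul (hg r))
      (Eventually.of_forall fun r => Eventually.of_forall fun z => by
        gcongr
        exact Set.inter_subset_left) (by rw [← e]; exact hfin.ne)
      (Eventually.of_forall fun z => ?_)
    exact ENNReal.Tendsto.const_mul (tendsto_volume_inter_translate hbdd hmeas z)
      (Or.inr (by simp))
  have hlim' := ENNReal.Tendsto.div_const hlim (Or.inr hpos.ne') (b := volume Ω)
  rw [ENNReal.div_self hpos.ne' hfin.ne] at hlim'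
  refine hlim'.congr' ?_
  filter_upwards [eventually_gt_atTop 0] with r hr
  rw [lintegral_lintegral_enorm_sq_shiftLp φ (hmeas.const_smul₀ r), volume_smul_set hr]
  simp_rw [volume_smul_inter_translate hr, mul_left_comm _ (ENNReal.ofReal (r ^ 2))]
  rw [lintegral_const_mul _ (by exact hk.mul (hg r)), ENNReal.mul_div_mul_left _ _ (by simp [hr.ne'])
    ENNReal.ofReal_ne_top]

/-! ### The limit of the normalized count. -/

theorem tendsto_eigenvalueCount_div_volume (φ : SignalSpace) (hφ : ‖φ‖ = 1) {Ω : Set (ℝ × ℝ)}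
    (hbdd : Bornology.IsBounded Ω) (hmeas : MeasurableSet Ω) (hpos : 0 < volume Ω) {lam : ℝ}
    (h0 : 0 < lam) (h1 : lam < 1) :
    Tendsto (fun r : ℝ => eigenvalueCount φ lam (r • Ω) / volume (r • Ω)) atTop (nhds 1) := by
  have hB := tendsto_hilbertSchmidt_div_volume φ hφ hbdd hmeas hpos
  set c := ENNReal.ofReal (1 / lam + 1 / (1 - lam)) with hc
  have hct : c ≠ ∞ := ENNReal.ofReal_ne_top
  have hcB := ENNReal.Tendsto.const_mul hB (Or.inr hct)
  rw [mul_one] at hcB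
  -- With `B` and `V` now taken for the dilated region, the squeezing bounds are `1 + c B / V - c`
  -- and `1 + c - c B / V`. Both tend to `1` because `B / V → 1` and `c` is finite.
  have hlow := ENNReal.Tendsto.sub (tendsto_const_nhds.add hcB) (tendsto_const_nhds (x := c))
    (Or.inr hct) (a := 1 + c)
  have hupp := ENNReal.Tendsto.sub (tendsto_const_nhds (x := 1 + c)) hcB (Or.inr hct)
  rw [ENNReal.add_sub_cancel_right hct] at hlow hupp
  refine tendsto_of_tendsto_of_tendsto_of_le_of_le' hlow hupp ?_ ?_ <;>
  · filter_upwards [eventually_gt_atTop 0] with r hr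
    have hV0 : volume (r • Ω) ≠ 0 := by
      rw [volume_smul_set hr]
      simp [hpos.ne', hr.ne']
    have hVt : volume (r • Ω) ≠ ∞ := (hbdd.smul₀ r).measure_lt_top.ne
    obtain ⟨hb1, hb2⟩ := eigenvalueCount_bounds φ hφ (hbdd.smul₀ r) h0 h1
    have hb1' := ENNReal.div_le_div_right hb1 (volume (r • Ω))
    have hb2' := ENNReal.div_le_div_right hb2 (volume (r • Ω))
    simp only [ENNReal.add_div, mul_div_assoc, ENNReal.div_self hV0 hVt, mul_one] at hb1' hb2'
    first
      | exact tsub_le_iff_right.2 hb2'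
      | exact ENNReal.le_sub_of_add_le_right (ne_top_of_le_ne_top
          (ENNReal.add_ne_top.2 ⟨ENNReal.one_ne_top, hct⟩) (le_add_self.trans hb1')) hb1'

theorem mainTheorem1 (φ : SignalSpace) (hφ : ‖φ‖ = 1)
    (Ω : Set (ℝ × ℝ)) (hbdd : Bornology.IsBounded Ω) (hmeas : MeasurableSet Ω)
    (hpos : 0 < volume Ω) (lam : ℝ) (hlam0 : 0 < lam) (hlam1 : lam < 1) :
    Filter.liminf
      (fun r : ℝ => eigenvalueCount φ lam (r • Ω) / volume (r • Ω)) Filter.atTop = 1 :=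
  (tendsto_eigenvalueCount_div_volume φ hφ hbdd hmeas hpos hlam0 hlam1).liminf_eq
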